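/- For a positive integer $n$ and a set $A\subseteq\mathbb Z/n\mathbb Z$ put $D(A)=|A|/n$. Call $A$ sum-free if $A\cap(A+A)=\emptyset$ and product-free if $A\cap(A\cdot A)=\emptyset$, where $A+A=\{a+b: a,b\in A\}$ and $A\cdot A=\{ab: a,b\in A\}$. Let $D'(n)$ be the maximum of $D(A)$ over all $A\subseteq\mathbb Z/n\mathbb Z$ that are both sum-free and product-free. Theorem. There is a constant $\kappa'>0$ such that for infinitely many positive integers $n$ $$D'(n)\ \ge\ \frac12-\frac{\kappa'}{(\log\log n)^{1-\frac e2\log 2}\,(\log\log\log n)^{1/2}}.$$ Moreover, explicit examples are as follows. For a positive integer $x$ let $\ell_x=\operatorname{lcm}(1,2,\dots,x)$ and $n_x=\ell_x^2$; for $x\ge 3$ let $k=\lfloor\frac e4\log\log x\rfloor$ and let $A_x$ be the set of residues $a$ modulo $n_x$ for which $\gcd(a,n_x)$ is an odd divisor $d$ of $\ell_x$ with $k<\Omega(d)<2k$, where $\Omega(d)$ is the number of prime factors of $d$ counted with multiplicity. Then, for all sufficiently large $x$, the set $A_x$ is sum-free and product-free and $$D(A_x)\ \ge\ \frac12-\frac{\kappa'}{(\log\log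 n_x)^{1-\frac e2\log 2}\,(\log\log\log n_x)^{1/2}}.$$ -/

import Mathlib

open Filter
open scoped Pointwise

noncomputable section

namespace SumProductFree

/-- `A` is sum-free: `A ∩ (A + A) = ∅`, where `A + A = {a + b : a, b ∈ A}` (`a = b` allowed). -/
def IsSumFree {R : Type*} [Add R] (A : Set R) : Prop := A ∩ (A + A) = ∅

/-- `A` is product-free: `A ∩ (A * A) = ∅`, where `A * A = {a * b : a, b ∈ A}`
(`a = b` allowed). -/
def IsProductFree {R : Type*} [Mul R] (A : Set R) : Prop := A ∩ (A * A) = ∅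

/-- The density `D(A) = |A| / n` of a set of residues modulo `n`. -/
def density {n : ℕ} (A : Set (ZMod n)) : ℝ := (A.ncard : ℝ) / n

/-- The densities of the sum-free, product-free subsets of `ℤ/nℤ`. -/
def densities (n : ℕ) : Set ℝ :=
  {δ | ∃ A : Set (ZMod n), IsSumFree A ∧ IsProductFree A ∧ δ = density A}

/-- `D'(n)`: the largest density of a sum-free, product-free subset of `ℤ/nℤ`.
It is a maximum for `n > 0`, see `isGreatest_maxDensity`. -/
def maxDensity (n : ℕ) : ℝ := sSup (densities n)

theorem isGreatest_maxDensity (n : ℕ) (hn : n ≠ 0) :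
    IsGreatest (densities n) (maxDensity n) := by
  have : NeZero n := ⟨hn⟩
  have hfin : (densities n).Finite := by
    refine (Set.finite_range (fun A : Set (ZMod n) => density A)).subset ?_
    rintro δ ⟨A, _, _, rfl⟩
    exact ⟨A, rfl⟩
  have hne : (densities n).Nonempty :=
    ⟨_, ∅, by simp [IsSumFree], by simp [IsProductFree], rfl⟩
  exact ⟨hne.csSup_mem hfin, fun _ h => le_csSup hfin.bddAbove h⟩

/-- `(log log n)^{1 - (e/2) log 2} (log log log n)^{1/2}`, meaningful for `n ≥ 16`. -/
def rate (n : ℕ) : ℝ :=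
  Real.log (Real.log n) ^ (1 - Real.exp 1 / 2 * Real.log 2) *
    Real.log (Real.log (Real.log n)) ^ (1 / 2 : ℝ)

/-- `ℓ_x`, the least common multiple of the integers in `[1, x]`. -/
def lcmUpTo (x : ℕ) : ℕ := (Finset.Icc 1 x).lcm id

/-- `n_x = ℓ_x ^ 2`. -/
def exampleModulus (x : ℕ) : ℕ := lcmUpTo x ^ 2

/-- `k(x) = ⌊(e/4) log log x⌋`. -/
def exampleK (x : ℕ) : ℕ := ⌊Real.exp 1 / 4 * Real.log (Real.log x)⌋₊

/-- The odd divisors `d` of `ℓ_x` with `k < Ω(d) < 2k`, where `Ω` counts prime factors with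
multiplicity. -/
def exampleDivisors (x : ℕ) : Set ℕ :=
  {d | d ∣ lcmUpTo x ∧ Odd d ∧ exampleK x < ArithmeticFunction.cardFactors d ∧
    ArithmeticFunction.cardFactors d < 2 * exampleK x}

/-- The residues `a` modulo `n_x` whose greatest common divisor with `n_x` is an odd divisor `d`
of `ℓ_x` with `k < Ω(d) < 2k`. -/
def exampleSet (x : ℕ) : Set (ZMod (exampleModulus x)) :=
  {a | Nat.gcd a.val (exampleModulus x) ∈ exampleDivisors x}

end SumProductFree

end

namespace SumProductFree

/-! Write ℓ for `lcmUpTo x`, n = ℓ², L = log log x and k = `exampleK x`. Members of the set are odd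
and n is even, so the set is sum-free. If gcd(a, n) and gcd(b, n) divide ℓ, their product divides
both n and ab, so Ω(gcd(ab, n)) ≥ 2(k + 1), which puts ab outside the set.

For the density, the residues with gcd equal to d ∣ ℓ number φ(n/d) = φ(n)/d, because n/d keeps
every prime of n. The odd residues that are lost have Ω(gcd) ≤ k, or Ω(gcd) ≥ 2k, or a gcd not
dividing ℓ (`half_sub_density_exampleSet_le`). The last kind costs O(x^(-1/4)). The others cost
φ(n)/n ≤ 1/log x = e^(-L) times sums of 1/d over odd d with Ω(d) far from L. These are tails of a
Poisson law of mean about L, each dominated by its extreme term S^K/K! with S = L + 3 and K = k or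
2k (`sum_inv_cardFactors_le_le`, `sum_inv_le_cardFactors_le`).

For K = αL the term S^K/K! is about exp(α(1 - log α)L)/√L. The values at α and 2α agree exactly when
α = e/4, and the common exponent is then (e/2) log 2. This explains the choice of k and the exponent
in the theorem. -/

/-! ### Upper bounds for sums over primes. -/

/-- Chebyshev's argument: each p ≤ n divides n! at least ⌊n/p⌋ times, and log n! ≤ n log n. The
factor 2 pays for n/p ≤ 2⌊n/p⌋. -/
theorem sum_primesLE_log_div_le {n : ℕ} (hn : n ≠ 0) :
    ∑ p ∈ n.primesLE, Real.log p / p ≤ 2 * Real.log n := by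
  have hn0 : (0 : ℝ) < n := by positivity
  have hval : ∀ p ∈ n.primesLE, n / p ≤ (n.factorial).factorization p := by
    intro p hp
    have hpp := Nat.prime_of_mem_primesLE hp
    have hpn := Nat.le_of_mem_primesLE hp
    have := Fact.mk hpp
    rw [Nat.factorization_def _ hpp,
      padicValNat_factorial (b := Nat.log p n + 1) (Nat.lt_succ_self _)]
    have h1 : 1 ∈ Finset.Ico 1 (Nat.log p n + 1) := by
      have := Nat.log_pos hpp.one_lt hpn
      exact Finset.mem_Ico.2 ⟨le_rfl, by omega⟩
    simpa using Finset.single_le_sum (f := fun i => n / p ^ i) (fun _ _ => Nat.zero_le _) h1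
  have hfac : ∑ p ∈ n.primesLE, ((n / p : ℕ) : ℝ) * Real.log p ≤ Real.log n.factorial := by
    have hlog : Real.log n.factorial =
        ∑ p ∈ n.factorial.primeFactors, (n.factorial.factorization p : ℝ) * Real.log p := by
      conv_lhs => rw [← Nat.prod_factorization_pow_eq_self n.factorial_ne_zero,
        Nat.prod_factorization_eq_prod_primeFactors]
      push_cast
      rw [Real.log_prod]
      · simp
      · intro p hp
        have := (Nat.prime_of_mem_primeFactors hp).pos
        positivity
    rw [hlog]
    refine (Finset.sum_le_sum (g := fun p => (n.factorial.factorization p : ℝ) * Real.log p)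
      fun p hp => ?_).trans (Finset.sum_le_sum_of_subset_of_nonneg ?_ ?_)
    · gcongr
      exact hval p hp
    · intro p hp
      have hpp := Nat.prime_of_mem_primesLE hp
      exact Nat.mem_primeFactors.2 ⟨hpp, hpp.dvd_factorial.2 (Nat.le_of_mem_primesLE hp),
        n.factorial_ne_zero⟩
    · intro p _ _
      positivity
  have hle : Real.log n.factorial ≤ n * Real.log n := by
    rw [← Real.log_pow]
    apply Real.log_le_log (by positivity)
    exact_mod_cast Nat.factorial_le_pow n
  have hdiv : ∀ p ∈ n.primesLE,
      (n : ℝ) * (Real.log p / p) ≤ 2 * (((n / p : ℕ) : ℝ) * Real.log p) := by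
    intro p hp
    have hpp := Nat.prime_of_mem_primesLE hp
    have hpn := Nat.le_of_mem_primesLE hp
    have hp0 : (0 : ℝ) < p := by exact_mod_cast hpp.pos
    have h2 : n ≤ 2 * (n / p) * p := by
      have h1 : 1 ≤ n / p := Nat.div_pos hpn hpp.pos
      have h3 := Nat.lt_div_mul_add (a := n) hpp.pos
      nlinarith
    have h2' : (n : ℝ) / p ≤ 2 * ((n / p : ℕ) : ℝ) := by
      rw [div_le_iff₀ hp0]
      exact_mod_cast h2
    have hlp : 0 ≤ Real.log p := Real.log_natCast_nonneg p
    calc (n : ℝ) * (Real.log p / p) = n / p * Real.log p := by ring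
      _ ≤ 2 * ((n / p : ℕ) : ℝ) * Real.log p := by gcongr
      _ = _ := by ring
  have h := Finset.sum_le_sum hdiv
  rw [← Finset.mul_sum, ← Finset.mul_sum] at h
  refine le_of_mul_le_mul_left ?_ hn0
  linarith

theorem tsum_nat_rpow_neg_le {s : ℝ} (hs : 1 < s) :
    ∑' n : ℕ, (n : ℝ) ^ (-s) ≤ 1 + 1 / (s - 1) := by
  have h := ZetaAsymptotics.zeta_limit_aux1 hs
  have h1 : 0 ≤ ZetaAsymptotics.termTSum s :=
    tsum_nonneg fun n => ZetaAsymptotics.term_nonneg _ _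
  have h2 : ∑' n : ℕ, (n : ℝ) ^ (-s) = ∑' n : ℕ, 1 / ((n : ℝ) + 1) ^ s := by
    rw [Summable.tsum_eq_zero_add (Real.summable_nat_rpow.2 (by linarith))]
    rw [Nat.cast_zero, Real.zero_rpow (by linarith), zero_add]
    refine tsum_congr fun n => ?_
    rw [Real.rpow_neg (by positivity)]
    push_cast
    rw [one_div]
  rw [h2]
  nlinarith

/-- The finite Euler product is a sum over smooth numbers, hence at most ζ(s); take logarithms and
use u ≤ -log(1 - u). -/
theorem sum_primesLE_rpow_neg_le {s : ℝ} (hs : 1 < s) (n : ℕ) :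
    ∑ p ∈ n.primesLE, (p : ℝ) ^ (-s) ≤ Real.log (1 + 1 / (s - 1)) := by
  let f : ℕ →* ℝ :=
    { toFun := fun m => (m : ℝ) ^ (-s)
      map_one' := by simp
      map_mul' := fun a b => by
        push_cast
        exact Real.mul_rpow (by positivity) (by positivity) }
  have hsum : Summable f := Real.summable_nat_rpow.2 (by linarith)
  have hprod := EulerProduct.prod_primesBelow_geometric_eq_tsum_smoothNumbers hsum (n + 1)
  have hpos : ∀ p : ℕ, p.Prime → 0 < 1 - f p := by
    intro p hp
    have : f p < 1 := Real.rpow_lt_one_of_one_lt_of_neg (by exact_mod_cast hp.one_lt) (by linarith)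
    linarith
  have hle : ∏ p ∈ (n + 1).primesBelow, (1 - f p)⁻¹ ≤ 1 + 1 / (s - 1) := by
    rw [hprod]
    refine le_trans ?_ (tsum_nat_rpow_neg_le hs)
    exact hsum.tsum_subtype_le (fun m : ℕ => f m) (n + 1).smoothNumbers
      (fun m => by change (0 : ℝ) ≤ (m : ℝ) ^ (-s); positivity)
  have hset : n.primesLE = (n + 1).primesBelow := by
    ext p
    simp [Nat.mem_primesLE, Nat.mem_primesBelow]
  rw [hset]
  refine le_trans ?_ (Real.log_le_log (Finset.prod_pos fun p hp => ?_) hle)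
  · rw [Real.log_prod (fun p hp => (inv_pos.2 (hpos p (Nat.prime_of_mem_primesBelow hp))).ne')]
    refine Finset.sum_le_sum fun p hp => ?_
    have := Real.log_le_sub_one_of_pos (hpos p (Nat.prime_of_mem_primesBelow hp))
    rw [Real.log_inv]
    change f p ≤ _
    linarith
  · exact inv_pos.2 (hpos p (Nat.prime_of_mem_primesBelow hp))

/-- Shift the exponent to s = 1 + 1/log n. The Euler product bounds the shifted sum by log(1 + log
n), and the cost of the shift is at most Σ (log p)/p divided by log n, which is at most 2. -/
theorem sum_primesLE_inv_le {n : ℕ} (hn : 3 ≤ n) :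
    ∑ p ∈ n.primesLE, (p : ℝ)⁻¹ ≤ Real.log (Real.log n) + 3 := by
  have hn0 : (0 : ℝ) < n := by positivity
  have hlog : 1 ≤ Real.log n := by
    rw [Real.le_log_iff_exp_le hn0]
    have h3 : (3 : ℝ) ≤ n := by exact_mod_cast hn
    linarith [Real.exp_one_lt_d9]
  have hlog0 : 0 < Real.log n := by linarith
  set s := 1 + 1 / Real.log n with hs
  have hs1 : 1 < s := by
    have : 0 < 1 / Real.log n := by positivity
    linarith
  have hA := sum_primesLE_rpow_neg_le hs1 n
  have hB := sum_primesLE_log_div_le (n := n) (by omega)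
  have hdiff : ∀ p ∈ n.primesLE, (p : ℝ)⁻¹ ≤ (p : ℝ) ^ (-s) + Real.log p / p / Real.log n := by
    intro p hp
    have hp0 : (0 : ℝ) < p := by exact_mod_cast (Nat.prime_of_mem_primesLE hp).pos
    have h1 : (p : ℝ) ^ (-s) = (p : ℝ)⁻¹ * Real.exp (-(Real.log p / Real.log n)) := by
      rw [hs, neg_add, Real.rpow_add hp0, Real.rpow_neg_one, Real.rpow_def_of_pos hp0]
      congr 2
      ring
    rw [h1]
    have h2 := Real.add_one_le_exp (-(Real.log p / Real.log n))
    have h3 : (0 : ℝ) ≤ (p : ℝ)⁻¹ := by positivity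
    have h4 := mul_le_mul_of_nonneg_left h2 h3
    have h5 : Real.log p / p / Real.log n = (p : ℝ)⁻¹ * (Real.log p / Real.log n) := by
      field_simp
    rw [h5]
    linarith
  have h := Finset.sum_le_sum hdiff
  rw [Finset.sum_add_distrib, ← Finset.sum_div] at h
  have h2 : (∑ p ∈ n.primesLE, Real.log p / p) / Real.log n ≤ 2 := by
    rw [div_le_iff₀ hlog0]
    exact hB
  have h3 : Real.log (1 + 1 / (s - 1)) ≤ Real.log (Real.log n) + 1 := by
    have : 1 + 1 / (s - 1) = 1 + Real.log n := by
      rw [hs]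
      simp
    rw [this]
    have h4 : Real.log (1 + Real.log n) ≤ Real.log (2 * Real.log n) :=
      Real.log_le_log (by linarith) (by linarith)
    rw [Real.log_mul (by norm_num) hlog0.ne'] at h4
    linarith [Real.log_two_lt_d9]
  linarith

/-! ### Sums of 1/d over integers with prescribed Ω(d). -/

/-- Expanding the m-th power produces each product over an m-subset m! times. The induction on `P`
uses only two terms of the binomial expansion of (S + a)^(m+1). -/
theorem sum_powersetCard_prod_le {ι : Type*} [DecidableEq ι] {a : ι → ℝ} (ha : ∀ i, 0 ≤ a i)
    (P : Finset ι) (m : ℕ) :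
    ∑ u ∈ P.powersetCard m, ∏ i ∈ u, a i ≤ (∑ i ∈ P, a i) ^ m / m.factorial := by
  induction P using Finset.induction_on generalizing m with
  | empty =>
    cases m with
    | zero => simp
    | succ m => simp [Finset.powersetCard_eq_empty.2 (show (∅ : Finset ι).card < m + 1 by simp)]
  | insert q P hq ih =>
    cases m with
    | zero => simp
    | succ m =>
      have hS : 0 ≤ ∑ i ∈ P, a i := Finset.sum_nonneg fun i _ => ha i
      rw [Finset.powersetCard_succ_insert hq, Finset.sum_union, Finset.sum_image,
        Finset.sum_insert hq]
      · have h1 : ∑ u ∈ P.powersetCard m, ∏ i ∈ insert q u, a i =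
            a q * ∑ u ∈ P.powersetCard m, ∏ i ∈ u, a i := by
          rw [Finset.mul_sum]
          refine Finset.sum_congr rfl fun u hu => ?_
          rw [Finset.prod_insert fun h => hq ((Finset.mem_powersetCard.1 hu).1 h)]
        rw [h1]
        set S := ∑ i ∈ P, a i
        have hb : S ^ (m + 1) + (m + 1) * (a q * S ^ m) ≤ (a q + S) ^ (m + 1) := by
          have := pow_add_mul_le_add_pow (a := S) (b := a q) hS (by linarith [ha q]) (m + 1)
          push_cast at this
          rw [add_comm (a q)]
          linarith
        calc _ ≤ S ^ (m + 1) / (m + 1).factorial + a q * (S ^ m / m.factorial) :=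
              add_le_add (ih (m + 1)) (mul_le_mul_of_nonneg_left (ih m) (ha q))
          _ = (S ^ (m + 1) + (m + 1) * (a q * S ^ m)) / (m + 1).factorial := by
              rw [Nat.factorial_succ]
              push_cast
              field_simp
          _ ≤ _ := by gcongr
      · intro u hu v hv h
        have hu' : q ∉ u := fun h => hq ((Finset.mem_powersetCard.1 hu).1 h)
        have hv' : q ∉ v := fun h => hq ((Finset.mem_powersetCard.1 hv).1 h)
        rw [← Finset.erase_insert hu', ← Finset.erase_insert hv', h]
      · rw [Finset.disjoint_left]
        intro u hu hu'
        obtain ⟨v, _, rfl⟩ := Finset.mem_image.1 hu'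
        exact hq ((Finset.mem_powersetCard.1 hu).1 (Finset.mem_insert_self _ _))

theorem sum_inv_squarefree_le {P T : Finset ℕ} {m : ℕ}
    (hT : ∀ s ∈ T, Squarefree s ∧ s.primeFactors ⊆ P ∧ ArithmeticFunction.cardFactors s = m) :
    ∑ s ∈ T, (s : ℝ)⁻¹ ≤ (∑ p ∈ P, (p : ℝ)⁻¹) ^ m / m.factorial := by
  refine le_trans ?_ (sum_powersetCard_prod_le (a := fun p : ℕ => (p : ℝ)⁻¹)
    (fun p => by positivity) P m)
  have hinj : Set.InjOn Nat.primeFactors (T : Set ℕ) := by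
    intro s hs t ht h
    rw [← Nat.prod_primeFactors_of_squarefree (hT s hs).1,
      ← Nat.prod_primeFactors_of_squarefree (hT t ht).1, h]
  have h1 : ∑ s ∈ T, (s : ℝ)⁻¹ = ∑ u ∈ T.image Nat.primeFactors, ∏ p ∈ u, (p : ℝ)⁻¹ := by
    rw [Finset.sum_image hinj]
    refine Finset.sum_congr rfl fun s hs => ?_
    conv_lhs => rw [← Nat.prod_primeFactors_of_squarefree (hT s hs).1]
    push_cast
    rw [Finset.prod_inv_distrib]
  rw [h1]
  refine Finset.sum_le_sum_of_subset_of_nonneg ?_ fun u _ _ =>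
    Finset.prod_nonneg fun p _ => by positivity
  intro u hu
  obtain ⟨s, hs, rfl⟩ := Finset.mem_image.1 hu
  obtain ⟨hsq, hP, hm⟩ := hT s hs
  refine Finset.mem_powersetCard.2 ⟨hP, ?_⟩
  rw [← hm, ← (ArithmeticFunction.cardDistinctFactors_eq_cardFactors_iff_squarefree
    hsq.ne_zero).2 hsq, ArithmeticFunction.cardDistinctFactors_apply]
  rfl

/-- Equivalently K^j/j! ≤ K^K/K!: a Poisson law of mean K has a mode at K. -/
theorem pow_mul_factorial_le (K j : ℕ) : K ^ j * K.factorial ≤ K ^ K * j.factorial := by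
  rcases le_total K j with h | h
  · calc K ^ j * K.factorial = K ^ K * (K.factorial * K ^ (j - K)) := by
          rw [mul_comm K.factorial, ← mul_assoc, ← pow_add, Nat.add_sub_cancel' h]
      _ ≤ _ := Nat.mul_le_mul_left _ (Nat.factorial_mul_pow_sub_le_factorial h)
  · have h1 : K.factorial ≤ j.factorial * K ^ (K - j) := by
      obtain ⟨i, rfl⟩ := Nat.exists_eq_add_of_le h
      rw [Nat.add_sub_cancel_left, ← Nat.factorial_mul_ascFactorial]
      refine Nat.mul_le_mul_left _ ?_
      exact Nat.ascFactorial_le_pow_add _ _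
    calc K ^ j * K.factorial ≤ K ^ j * (j.factorial * K ^ (K - j)) := Nat.mul_le_mul_left _ h1
      _ = K ^ K * j.factorial := by
          rw [mul_comm j.factorial, ← mul_assoc, ← pow_add, Nat.add_sub_cancel' h]

/-- With r = K/S the last factor is r^(K-j), so Poisson terms of mean S decay geometrically from K
downwards if r < 1 and upwards if r > 1. -/
theorem pow_div_factorial_le {S : ℝ} (hS : 0 < S) {K : ℕ} (hK : K ≠ 0) (j : ℕ) :
    S ^ j / j.factorial ≤ S ^ K / K.factorial * ((K / S) ^ K / (K / S) ^ j) := by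
  have hK' : (0 : ℝ) < K := by positivity
  have h : ((K : ℝ)) ^ j * K.factorial ≤ (K : ℝ) ^ K * j.factorial := by
    exact_mod_cast pow_mul_factorial_le K j
  have h1 : S ^ K / K.factorial * ((K / S) ^ K / (K / S) ^ j) =
      S ^ j * ((K : ℝ) ^ K / (K.factorial * (K : ℝ) ^ j)) := by
    rw [div_pow, div_pow]
    field_simp
  rw [h1, div_eq_mul_inv]
  refine mul_le_mul_of_nonneg_left ?_ (by positivity)
  rw [inv_eq_one_div, div_le_div_iff₀ (by positivity) (by positivity)]
  linarith

theorem three_pow_cardFactors_le {t : ℕ} (ht : Odd t) :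
    3 ^ ArithmeticFunction.cardFactors t ≤ t := by
  have ht0 : t ≠ 0 := by rintro rfl; simp at ht
  rw [ArithmeticFunction.cardFactors_apply]
  conv_rhs => rw [← Nat.prod_primeFactorsList ht0]
  refine List.pow_card_le_prod (M := ℕ) _ 3 fun p hp => ?_
  have hpp := Nat.prime_of_mem_primeFactorsList hp
  have := (ht.of_dvd_nat (Nat.dvd_of_mem_primeFactorsList hp))
  have h2 := hpp.two_le
  rcases this with ⟨a, rfl⟩
  omega

/-- This controls the square part t² of d: against the weight t^(-2) it leaves the summable
t^(-5/4). Oddness enters through 3^Ω(t) ≤ t, and (3/2)² ≤ 3^(3/4). -/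
theorem pow_two_mul_cardFactors_le {t : ℕ} (ht : Odd t) {r : ℝ} (hr0 : 0 ≤ r) (hr : r ≤ 3 / 2) :
    r ^ (2 * ArithmeticFunction.cardFactors t) ≤ (t : ℝ) ^ (3 / 4 : ℝ) := by
  have h3 : r ^ 2 ≤ (3 : ℝ) ^ (3 / 4 : ℝ) := by
    have h1 : (r ^ 2) ^ 4 ≤ (3 : ℝ) ^ 3 := by
      calc (r ^ 2) ^ 4 ≤ ((3 / 2) ^ 2) ^ 4 := by gcongr
        _ ≤ _ := by norm_num
    have h2 : ((3 : ℝ) ^ (3 / 4 : ℝ)) ^ 4 = 3 ^ 3 := by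
      rw [← Real.rpow_natCast, ← Real.rpow_mul (by norm_num)]
      norm_num
    rw [← h2] at h1
    exact le_of_pow_le_pow_left₀ (by norm_num) (by positivity) h1
  calc r ^ (2 * ArithmeticFunction.cardFactors t)
      ≤ ((3 : ℝ) ^ (3 / 4 : ℝ)) ^ ArithmeticFunction.cardFactors t := by
        rw [pow_mul]
        gcongr
    _ = ((3 : ℝ) ^ ArithmeticFunction.cardFactors t) ^ (3 / 4 : ℝ) := by
        rw [← Real.rpow_natCast, ← Real.rpow_natCast, ← Real.rpow_mul (by norm_num),
          ← Real.rpow_mul (by norm_num), mul_comm]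
    _ ≤ _ := by
        gcongr
        exact_mod_cast three_pow_cardFactors_le ht

/-- The constant `∑ t^{-5/4}`. -/
noncomputable def squarePartConst : ℝ := ∑' t : ℕ, (t : ℝ) ^ (-(5 / 4) : ℝ)

theorem squarePartConst_nonneg : 0 ≤ squarePartConst := tsum_nonneg fun t => by positivity

/-- Write d = t²s with s squarefree, so Ω(s) = j - 2Ω(t). For fixed t the sum over s is at most
S^(j-2Ω(t))/(j-2Ω(t))!. Comparing it with the K-th term costs an extra r^(2Ω(t)), which the sum over
t absorbs. -/
theorem sum_inv_cardFactors_eq_le {P D : Finset ℕ} {S : ℝ} {K j : ℕ} (hS : 0 < S) (hK : K ≠ 0)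
    (hP : ∑ p ∈ P, (p : ℝ)⁻¹ ≤ S) (hr : (K : ℝ) / S ≤ 3 / 2)
    (hD : ∀ d ∈ D, Odd d ∧ d.primeFactors ⊆ P ∧ ArithmeticFunction.cardFactors d = j) :
    ∑ d ∈ D, (d : ℝ)⁻¹ ≤
      squarePartConst * (S ^ K / K.factorial) * ((K / S) ^ K / (K / S) ^ j) := by
  choose s t hts hsq using Nat.sq_mul_squarefree
  set r : ℝ := K / S with hrdef
  have hr0 : 0 < r := by positivity
  have hfib : ∀ u ∈ D.image t, ∑ d ∈ D with t d = u, (d : ℝ)⁻¹ ≤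
      (u : ℝ) ^ (-(5 / 4) : ℝ) * (S ^ K / K.factorial * (r ^ K / r ^ j)) := by
    intro u hu
    obtain ⟨d₀, hd₀, rfl⟩ := Finset.mem_image.1 hu
    set u := t d₀
    have hu_odd : Odd u := (hD d₀ hd₀).1.of_dvd_nat
      (by rw [← hts d₀]; exact Dvd.dvd.mul_right (dvd_pow_self _ two_ne_zero) _)
    have hu0 : u ≠ 0 := by intro h; rw [h] at hu_odd; simp at hu_odd
    have hu0' : (0 : ℝ) < u := by positivity
    set w := ArithmeticFunction.cardFactors u
    have hwj : ∀ d ∈ D, t d = u → 2 * w + ArithmeticFunction.cardFactors (s d) = j := by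
      intro d hd htd
      rw [← (hD d hd).2.2]
      conv_rhs => rw [← hts d, htd]
      rw [ArithmeticFunction.cardFactors_mul (pow_ne_zero _ hu0) (hsq d).ne_zero,
        ArithmeticFunction.cardFactors_pow]
    have hinj : Set.InjOn s ((D.filter fun d => t d = u : Finset ℕ) : Set ℕ) := by
      intro a ha b hb h
      have ha' := (Finset.mem_filter.1 ha).2
      have hb' := (Finset.mem_filter.1 hb).2
      rw [← hts a, ← hts b, ha', hb', h]
    have h1 : ∑ d ∈ D with t d = u, (d : ℝ)⁻¹ =
        ((u : ℝ) ^ 2)⁻¹ * ∑ v ∈ (D.filter fun d => t d = u).image s, (v : ℝ)⁻¹ := by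
      rw [Finset.sum_image hinj, Finset.mul_sum]
      refine Finset.sum_congr rfl fun d hd => ?_
      conv_lhs => rw [← hts d, (Finset.mem_filter.1 hd).2]
      push_cast
      rw [mul_inv]
    have h2w : 2 * w ≤ j := by
      have := hwj d₀ hd₀ rfl
      omega
    have h2 : ∑ v ∈ (D.filter fun d => t d = u).image s, (v : ℝ)⁻¹ ≤
        S ^ (j - 2 * w) / (j - 2 * w).factorial := by
      refine (sum_inv_squarefree_le (P := P) (m := j - 2 * w) ?_).trans ?_
      · intro v hv
        obtain ⟨d, hd, rfl⟩ := Finset.mem_image.1 hv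
        obtain ⟨hdD, htd⟩ := Finset.mem_filter.1 hd
        refine ⟨hsq d, ?_, ?_⟩
        · refine (Nat.primeFactors_mono ⟨t d ^ 2, ?_⟩ ?_).trans (hD d hdD).2.1
          · rw [mul_comm, hts d]
          · intro h
            have := (hD d hdD).1
            rw [h] at this
            simp at this
        · have := hwj d hdD htd
          omega
      · gcongr
    have h3 := pow_div_factorial_le hS hK (j - 2 * w)
    rw [← hrdef] at h3
    have h4 : r ^ K / r ^ (j - 2 * w) = r ^ K / r ^ j * r ^ (2 * w) := by
      rw [div_mul_eq_mul_div, div_eq_div_iff (by positivity) (by positivity), mul_assoc,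
        ← pow_add (m := 2 * w), Nat.add_sub_cancel' h2w]
    have h5 := pow_two_mul_cardFactors_le hu_odd hr0.le hr
    have h6 : (u : ℝ) ^ (-(5 / 4) : ℝ) = ((u : ℝ) ^ 2)⁻¹ * (u : ℝ) ^ (3 / 4 : ℝ) := by
      rw [← Real.rpow_natCast, ← Real.rpow_neg hu0'.le, ← Real.rpow_add hu0']
      norm_num
    rw [h1, h6, mul_assoc]
    refine mul_le_mul_of_nonneg_left ?_ (by positivity)
    calc _ ≤ _ := h2.trans h3
      _ = r ^ (2 * w) * (S ^ K / K.factorial * (r ^ K / r ^ j)) := by rw [h4]; ring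
      _ ≤ _ := mul_le_mul_of_nonneg_right h5 (by positivity)
  calc ∑ d ∈ D, (d : ℝ)⁻¹ = ∑ u ∈ D.image t, ∑ d ∈ D with t d = u, (d : ℝ)⁻¹ :=
        (Finset.sum_fiberwise_of_maps_to (fun d hd => Finset.mem_image_of_mem t hd) _).symm
    _ ≤ ∑ u ∈ D.image t, (u : ℝ) ^ (-(5 / 4) : ℝ) * (S ^ K / K.factorial * (r ^ K / r ^ j)) :=
        Finset.sum_le_sum hfib
    _ ≤ squarePartConst * (S ^ K / K.factorial * (r ^ K / r ^ j)) := by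
        rw [← Finset.sum_mul]
        refine mul_le_mul_of_nonneg_right ?_ (by positivity)
        exact (Real.summable_nat_rpow.2 (by norm_num)).sum_le_tsum _ fun t _ => by positivity
    _ = _ := by ring

theorem sum_inv_cardFactors_le_le {P D : Finset ℕ} {S : ℝ} {K : ℕ} (hS : 0 < S) (hK : K ≠ 0)
    (hP : ∑ p ∈ P, (p : ℝ)⁻¹ ≤ S) (hr : (K : ℝ) / S < 1)
    (hD : ∀ d ∈ D, Odd d ∧ d.primeFactors ⊆ P ∧ ArithmeticFunction.cardFactors d ≤ K) :
    ∑ d ∈ D, (d : ℝ)⁻¹ ≤ squarePartConst * (S ^ K / K.factorial) * (1 - K / S)⁻¹ := by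
  set r : ℝ := K / S with hrdef
  have hr0 : 0 < r := by positivity
  have hmaps : ∀ d ∈ D, ArithmeticFunction.cardFactors d ∈ Finset.range (K + 1) := fun d hd =>
    Finset.mem_range.2 (Nat.lt_succ_of_le (hD d hd).2.2)
  rw [← Finset.sum_fiberwise_of_maps_to hmaps]
  have h1 : ∀ j ∈ Finset.range (K + 1),
      ∑ d ∈ D with ArithmeticFunction.cardFactors d = j, (d : ℝ)⁻¹ ≤
        squarePartConst * (S ^ K / K.factorial) * r ^ (K - j) := by
    intro j hj
    have hj' : j ≤ K := Nat.lt_succ_iff.1 (Finset.mem_range.1 hj)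
    have := sum_inv_cardFactors_eq_le (D := D.filter fun d => ArithmeticFunction.cardFactors d = j)
      (j := j) hS hK hP (by linarith) fun d hd => by
        obtain ⟨hd, hj⟩ := Finset.mem_filter.1 hd
        exact ⟨(hD d hd).1, (hD d hd).2.1, hj⟩
    rwa [pow_sub₀ _ hr0.ne' hj', ← div_eq_mul_inv]
  refine (Finset.sum_le_sum h1).trans ?_
  rw [← Finset.mul_sum]
  refine mul_le_mul_of_nonneg_left ?_ (mul_nonneg squarePartConst_nonneg (by positivity))
  have h2 : ∑ j ∈ Finset.range (K + 1), r ^ (K - j) = ∑ j ∈ Finset.range (K + 1), r ^ j := by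
    have := Finset.sum_range_reflect (fun j => r ^ j) (K + 1)
    simpa using this
  rw [h2, ← tsum_geometric_of_lt_one hr0.le hr]
  exact (summable_geometric_of_lt_one hr0.le hr).sum_le_tsum _ fun _ _ => by positivity

theorem sum_inv_le_cardFactors_le {P D : Finset ℕ} {S : ℝ} {K : ℕ} (hS : 0 < S) (hK : K ≠ 0)
    (hP : ∑ p ∈ P, (p : ℝ)⁻¹ ≤ S) (hr1 : 1 < (K : ℝ) / S) (hr : (K : ℝ) / S ≤ 3 / 2)
    (hD : ∀ d ∈ D, Odd d ∧ d.primeFactors ⊆ P ∧ K ≤ ArithmeticFunction.cardFactors d) :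
    ∑ d ∈ D, (d : ℝ)⁻¹ ≤ squarePartConst * (S ^ K / K.factorial) * (1 - (K / S)⁻¹)⁻¹ := by
  set r : ℝ := K / S with hrdef
  have hr0 : 0 < r := by positivity
  have hri : r⁻¹ < 1 := inv_lt_one_of_one_lt₀ hr1
  rw [← Finset.sum_fiberwise_of_maps_to
    (t := D.image fun d => ArithmeticFunction.cardFactors d - K)
    (g := fun d => ArithmeticFunction.cardFactors d - K)
    (fun d hd => Finset.mem_image_of_mem _ hd)]
  -- The truncated subtraction is harmless, since every d in `D` has Ω(d) ≥ K.
  have h1 : ∀ i ∈ D.image fun d => ArithmeticFunction.cardFactors d - K,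
      ∑ d ∈ D with ArithmeticFunction.cardFactors d - K = i, (d : ℝ)⁻¹ ≤
        squarePartConst * (S ^ K / K.factorial) * r⁻¹ ^ i := by
    intro i _
    have := sum_inv_cardFactors_eq_le
      (D := D.filter fun d => ArithmeticFunction.cardFactors d - K = i)
      (j := K + i) hS hK hP hr fun d hd => by
        obtain ⟨hd, hi⟩ := Finset.mem_filter.1 hd
        refine ⟨(hD d hd).1, (hD d hd).2.1, ?_⟩
        have := (hD d hd).2.2
        omega
    rwa [← hrdef, pow_add, div_mul_cancel_left₀ (by positivity), ← inv_pow] at this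
  refine (Finset.sum_le_sum h1).trans ?_
  rw [← Finset.mul_sum]
  refine mul_le_mul_of_nonneg_left ?_ (mul_nonneg squarePartConst_nonneg (by positivity))
  rw [← tsum_geometric_of_lt_one (by positivity) hri]
  exact (summable_geometric_of_lt_one (by positivity) hri).sum_le_tsum _ fun _ _ => by positivity

/-! ### The example is sum-free and product-free. -/

theorem lcmUpTo_eq (x : ℕ) : lcmUpTo x = Nat.lcmUpto x := rfl

theorem lcmUpTo_pos (x : ℕ) : 0 < lcmUpTo x := Nat.lcmUpto_pos x

theorem dvd_lcmUpTo {m x : ℕ} (hm : m ≠ 0) (hmx : m ≤ x) : m ∣ lcmUpTo x :=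
  Finset.dvd_lcm (f := id) (Finset.mem_Icc.2 ⟨Nat.one_le_iff_ne_zero.2 hm, hmx⟩)

theorem exampleModulus_pos (x : ℕ) : 0 < exampleModulus x := pow_pos (lcmUpTo_pos x) 2

theorem dvd_exampleModulus_of_dvd {d x : ℕ} (h : d ∣ lcmUpTo x) : d ∣ exampleModulus x :=
  h.trans (dvd_pow_self _ two_ne_zero)

theorem le_exampleModulus (x : ℕ) : x ≤ exampleModulus x := by
  rcases eq_or_ne x 0 with rfl | hx
  · exact Nat.zero_le _
  · exact Nat.le_of_dvd (exampleModulus_pos x)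
      (dvd_exampleModulus_of_dvd (dvd_lcmUpTo hx le_rfl))

instance (x : ℕ) : NeZero (exampleModulus x) := ⟨(exampleModulus_pos x).ne'⟩

theorem odd_val_of_mem_exampleSet {x : ℕ} (hx : 2 ≤ x) {a : ZMod (exampleModulus x)}
    (ha : a ∈ exampleSet x) : Odd a.val := by
  by_contra h
  rw [Nat.not_odd_iff_even] at h
  have h2 : 2 ∣ Nat.gcd a.val (exampleModulus x) :=
    Nat.dvd_gcd h.two_dvd (dvd_exampleModulus_of_dvd (dvd_lcmUpTo two_ne_zero hx))
  exact Nat.not_even_iff_odd.2 ha.2.1 (even_iff_two_dvd.2 h2)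

theorem isSumFree_exampleSet {x : ℕ} (hx : 2 ≤ x) : IsSumFree (exampleSet x) := by
  refine Set.eq_empty_iff_forall_notMem.2 ?_
  rintro _ ⟨hc, a, ha, b, hb, rfl⟩
  have h2 : 2 ∣ exampleModulus x := dvd_exampleModulus_of_dvd (dvd_lcmUpTo two_ne_zero hx)
  have hc' := odd_val_of_mem_exampleSet hx hc
  have ha' := odd_val_of_mem_exampleSet hx ha
  have hb' := odd_val_of_mem_exampleSet hx hb
  simp only [ZMod.val_add] at hc'
  rw [Nat.odd_iff, Nat.mod_mod_of_dvd _ h2, ← Nat.odd_iff] at hc'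
  exact Nat.not_even_iff_odd.2 hc' (ha'.add_odd hb')

theorem isProductFree_exampleSet (x : ℕ) : IsProductFree (exampleSet x) := by
  refine Set.eq_empty_iff_forall_notMem.2 ?_
  rintro _ ⟨hc, a, ha, b, hb, rfl⟩
  have hn := exampleModulus_pos x
  obtain ⟨hal, -, hak, -⟩ := ha
  obtain ⟨hbl, -, hbk, -⟩ := hb
  obtain ⟨-, -, -, hck⟩ := hc
  simp only [ZMod.val_mul] at hck
  set da := Nat.gcd a.val (exampleModulus x) with hda
  set db := Nat.gcd b.val (exampleModulus x) with hdb
  have hda0 : da ≠ 0 := (Nat.gcd_pos_of_pos_right _ hn).ne'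
  have hdb0 : db ≠ 0 := (Nat.gcd_pos_of_pos_right _ hn).ne'
  -- This is why the modulus is a square: the product of two divisors of ℓ divides n, so it survives
  -- reduction modulo n.
  have hdn : da * db ∣ exampleModulus x := by
    rw [exampleModulus, sq]
    exact mul_dvd_mul hal hbl
  have hdab : da * db ∣ a.val * b.val % exampleModulus x :=
    (Nat.dvd_mod_iff hdn).2 (mul_dvd_mul (Nat.gcd_dvd_left _ _) (Nat.gcd_dvd_left _ _))
  obtain ⟨e, he⟩ := Nat.dvd_gcd hdab hdn
  have he0 : e ≠ 0 := by
    rintro rfl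
    rw [mul_zero] at he
    exact (Nat.gcd_pos_of_pos_right _ hn).ne' he
  rw [he, ArithmeticFunction.cardFactors_mul (mul_ne_zero hda0 hdb0) he0,
    ArithmeticFunction.cardFactors_mul hda0 hdb0] at hck
  omega

/-! ### Counting residues by their gcd with the modulus. -/

theorem totient_div_of_dvd_lcmUpTo {d x : ℕ} (hd : d ∣ lcmUpTo x) :
    (Nat.totient (exampleModulus x / d) : ℝ) = Nat.totient (exampleModulus x) * (d : ℝ)⁻¹ := by
  obtain ⟨e, he⟩ := hd
  have hl := lcmUpTo_pos x
  have hd0 : d ≠ 0 := by rintro rfl; simp at he; omega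
  have he0 : e ≠ 0 := by rintro rfl; simp at he; omega
  have hdiv : exampleModulus x / d = e * lcmUpTo x := by
    rw [exampleModulus, sq]
    nth_rw 1 [he]
    rw [mul_assoc, Nat.mul_div_cancel_left _ (Nat.pos_of_ne_zero hd0)]
  have hpf : (e * lcmUpTo x).primeFactors = (exampleModulus x).primeFactors := by
    rw [exampleModulus, Nat.primeFactors_pow _ two_ne_zero, Nat.primeFactors_mul he0 hl.ne']
    exact Finset.union_eq_right.2 (Nat.primeFactors_mono ⟨d, by rw [he, mul_comm]⟩ hl.ne')
  have hd0' : (d : ℝ) ≠ 0 := by exact_mod_cast hd0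
  rw [hdiv]
  have h1 := Nat.totient_eq_mul_prod_factors (e * lcmUpTo x)
  have h2 := Nat.totient_eq_mul_prod_factors (exampleModulus x)
  rw [hpf] at h1
  have h1' : (Nat.totient (e * lcmUpTo x) : ℝ) = (e * lcmUpTo x : ℕ) *
      ∏ p ∈ (exampleModulus x).primeFactors, (1 - (p : ℝ)⁻¹) := by 
    have := congrArg (Rat.cast (K := ℝ)) h1
    push_cast at this ⊢
    exact this
  have h2' : (Nat.totient (exampleModulus x) : ℝ) = (exampleModulus x : ℕ) *
      ∏ p ∈ (exampleModulus x).primeFactors, (1 - (p : ℝ)⁻¹) := by 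
    have := congrArg (Rat.cast (K := ℝ)) h2
    push_cast at this ⊢
    exact this
  have h3 : exampleModulus x = d * (e * lcmUpTo x) := by
    rw [exampleModulus, sq]
    nth_rw 1 [he]
    rw [mul_assoc]
  rw [h1', h2']
  have h3' : ((exampleModulus x : ℕ) : ℝ) = d * (e * lcmUpTo x : ℕ) := by exact_mod_cast h3
  rw [h3']
  field_simp

theorem card_gcd_mem {x : ℕ} {E : Finset ℕ} (hE : ∀ d ∈ E, d ∣ lcmUpTo x) :
    (((Finset.range (exampleModulus x)).filter fun k => Nat.gcd k (exampleModulus x) ∈ E).card : ℝ)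
      = Nat.totient (exampleModulus x) * ∑ d ∈ E, (d : ℝ)⁻¹ := by
  rw [Finset.card_eq_sum_card_fiberwise (t := E) (f := fun k => Nat.gcd k (exampleModulus x))
    (s := (Finset.range (exampleModulus x)).filter fun k => Nat.gcd k (exampleModulus x) ∈ E)
    (fun k hk => (Finset.mem_filter.1 hk).2), Finset.mul_sum]
  push_cast
  refine Finset.sum_congr rfl fun d hd => ?_
  rw [← totient_div_of_dvd_lcmUpTo (hE d hd),
    Nat.totient_div_of_dvd (dvd_exampleModulus_of_dvd (hE d hd)), Finset.filter_filter]
  congr 2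
  refine Finset.filter_congr fun k _ => ?_
  rw [Nat.gcd_comm (exampleModulus x)]
  constructor
  · exact fun h => h.2
  · exact fun h => ⟨h ▸ hd, h⟩

/-- Residues whose gcd lies in [1, x] number φ(n) Σ_{d ≤ x} 1/d ≥ φ(n) log x, and there are at most
n of them. This replaces Mertens' product theorem. -/
theorem totient_div_mul_log_le (x : ℕ) :
    (Nat.totient (exampleModulus x) : ℝ) / exampleModulus x * Real.log x ≤ 1 := by
  have hn : (0 : ℝ) < exampleModulus x := by exact_mod_cast exampleModulus_pos x
  have h1 := card_gcd_mem (x := x) (E := Finset.Icc 1 x) fun d hd =>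
    dvd_lcmUpTo (by have := (Finset.mem_Icc.1 hd).1; omega) (Finset.mem_Icc.1 hd).2
  have h2 : (((Finset.range (exampleModulus x)).filter fun k =>
      Nat.gcd k (exampleModulus x) ∈ Finset.Icc 1 x).card : ℝ) ≤ exampleModulus x := by
    exact_mod_cast (Finset.card_filter_le _ _).trans_eq (Finset.card_range _)
  have h3 : Real.log x ≤ ∑ d ∈ Finset.Icc 1 x, (d : ℝ)⁻¹ := by
    rcases Nat.eq_zero_or_pos x with rfl | hx
    · simp
    have h4 := log_add_one_le_harmonic x
    rw [harmonic_eq_sum_Icc] at h4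
    push_cast at h4
    have h5 : Real.log x ≤ Real.log (x + 1) :=
      Real.log_le_log (by exact_mod_cast hx) (by linarith)
    linarith
  rw [div_mul_eq_mul_div, div_le_one hn]
  calc _ ≤ _ := mul_le_mul_of_nonneg_left h3 (by positivity)
    _ ≤ _ := h1 ▸ h2

theorem card_dvd_le {n m : ℕ} (hm : m ∣ n) :
    (((Finset.range n).filter fun k => m ∣ k).card : ℝ) ≤ n * (m : ℝ)⁻¹ := by
  rcases Nat.eq_zero_or_pos n with rfl | hn
  · simp
  have hm0 : 0 < m := Nat.pos_of_dvd_of_pos hm hn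
  have h1 : ((Finset.range n).filter fun k => m ∣ k) ⊆ (Finset.range (n / m)).image (m * ·) := by
    intro k hk
    obtain ⟨hk, i, rfl⟩ := Finset.mem_filter.1 hk
    refine Finset.mem_image.2 ⟨i, Finset.mem_range.2 ?_, rfl⟩
    rw [Nat.lt_div_iff_mul_lt' hm]
    exact Finset.mem_range.1 hk
  have h2 : ((Finset.range n).filter fun k => m ∣ k).card ≤ n / m :=
    (Finset.card_le_card h1).trans (Finset.card_image_le.trans_eq (Finset.card_range _))
  calc _ ≤ ((n / m : ℕ) : ℝ) := by exact_mod_cast h2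
    _ ≤ _ := by rw [← div_eq_mul_inv]; exact Nat.cast_div_le

open Classical in
theorem ncard_exampleSet (x : ℕ) :
    (exampleSet x).ncard = ((Finset.range (exampleModulus x)).filter fun k =>
      Nat.gcd k (exampleModulus x) ∈ exampleDivisors x).card := by
  rw [← Set.ncard_coe_finset]
  refine Set.ncard_congr (fun a _ => a.val) ?_ ?_ ?_
  · intro a ha
    exact Finset.mem_coe.2 (Finset.mem_filter.2 ⟨Finset.mem_range.2 (ZMod.val_lt a), ha⟩)
  · intro a b _ _ h
    exact ZMod.val_injective _ h
  · intro k hk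
    obtain ⟨hk1, hk2⟩ := Finset.mem_filter.1 (Finset.mem_coe.1 hk)
    have hv : (k : ZMod (exampleModulus x)).val = k := ZMod.val_cast_of_lt (Finset.mem_range.1 hk1)
    refine ⟨k, ?_, hv⟩
    rwa [exampleSet, Set.mem_ofPred_eq, hv]

/-- The odd divisors of `lcmUpTo x`. -/
def oddDivisors (x : ℕ) : Finset ℕ := (lcmUpTo x).divisors.filter Odd

theorem half_le_card_odd {n : ℕ} (h : Even n) :
    (n : ℝ) / 2 ≤ ((Finset.range n).filter Odd).card := by
  obtain ⟨m, rfl⟩ := h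
  have h1 : (Finset.range m).image (fun i => 2 * i + 1) ⊆ (Finset.range (m + m)).filter Odd := by
    intro k hk
    obtain ⟨i, hi, rfl⟩ := Finset.mem_image.1 hk
    refine Finset.mem_filter.2 ⟨Finset.mem_range.2 ?_, ⟨i, rfl⟩⟩
    have := Finset.mem_range.1 hi
    omega
  have h2 := Finset.card_le_card h1
  rw [Finset.card_image_of_injective _ (fun a b h => by simpa using h), Finset.card_range] at h2
  have h3 : (m : ℝ) ≤ ((Finset.range (m + m)).filter Odd).card := by exact_mod_cast h2
  push_cast
  linarith

/-- The exact power of p in ℓ has exponent `Nat.log p x`, so a failure of divisibility shows up as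
one more factor p. -/
theorem exists_prime_pow_dvd {g x : ℕ} (hg : g ∣ exampleModulus x) (hgl : ¬ g ∣ lcmUpTo x) :
    ∃ p ∈ x.primesLE, p ^ (Nat.log p x + 1) ∣ g := by
  have hn := (exampleModulus_pos x).ne'
  have hg0 : g ≠ 0 := ne_zero_of_dvd_ne_zero hn hg
  rw [← Nat.factorization_le_iff_dvd hg0 (lcmUpTo_pos x).ne', Finsupp.le_def] at hgl
  push Not at hgl
  obtain ⟨p, hp⟩ := hgl
  have hpp : p.Prime := by
    by_contra h
    exact Nat.not_lt_zero _ (hp.trans_eq (Nat.factorization_eq_zero_of_not_prime _ h))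
  refine ⟨p, ?_, ?_⟩
  · rw [← Nat.primeFactors_lcmUpto, ← lcmUpTo_eq, ← Nat.primeFactors_pow _ two_ne_zero]
    refine Nat.mem_primeFactors.2 ⟨hpp, ?_, hn⟩
    exact (Nat.dvd_of_factorization_pos (by omega)).trans hg
  · rw [lcmUpTo_eq, Nat.factorization_lcmUpto x hpp] at hp
    exact (pow_dvd_pow p hp).trans (Nat.ordProj_dvd g p)

theorem pow_log_add_one_dvd {p x : ℕ} (hp : p ∈ x.primesLE) :
    p ^ (Nat.log p x + 1) ∣ exampleModulus x := by
  have hpp := Nat.prime_of_mem_primesLE hp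
  have h1 := Nat.log_pos hpp.one_lt (Nat.le_of_mem_primesLE hp)
  refine (hpp.pow_dvd_iff_le_factorization (exampleModulus_pos x).ne').2 ?_
  rw [exampleModulus, Nat.factorization_pow, Finsupp.smul_apply, lcmUpTo_eq,
    Nat.factorization_lcmUpto x hpp, smul_eq_mul]
  omega

/-- A union bound: an odd residue outside the set has a gcd with too few or too many prime factors,
or a gcd not dividing ℓ. -/
theorem half_sub_density_exampleSet_le {x : ℕ} (hx : 2 ≤ x) :
    1 / 2 - density (exampleSet x) ≤
      (Nat.totient (exampleModulus x) : ℝ) / exampleModulus x *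
        (∑ d ∈ (oddDivisors x).filter (fun d => ArithmeticFunction.cardFactors d ≤ exampleK x),
            (d : ℝ)⁻¹ +
          ∑ d ∈ (oddDivisors x).filter
            (fun d => 2 * exampleK x ≤ ArithmeticFunction.cardFactors d), (d : ℝ)⁻¹) +
      ∑ p ∈ x.primesLE, ((p : ℝ) ^ (Nat.log p x + 1))⁻¹ := by
  classical
  set n := exampleModulus x with hn
  have hn0 : (0 : ℝ) < n := by exact_mod_cast exampleModulus_pos x
  have heven : Even n := even_iff_two_dvd.2 (dvd_exampleModulus_of_dvd (dvd_lcmUpTo two_ne_zero hx))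
  set E₁ := (oddDivisors x).filter fun d => ArithmeticFunction.cardFactors d ≤ exampleK x
  set E₂ := (oddDivisors x).filter fun d => 2 * exampleK x ≤ ArithmeticFunction.cardFactors d
  have hdvd : ∀ d ∈ oddDivisors x, d ∣ lcmUpTo x := fun d hd =>
    Nat.dvd_of_mem_divisors (Finset.mem_filter.1 hd).1
  have hsub : (Finset.range n).filter Odd ⊆
      ((Finset.range n).filter fun k => Nat.gcd k n ∈ exampleDivisors x) ∪
      (((Finset.range n).filter fun k => Nat.gcd k n ∈ E₁) ∪
      (((Finset.range n).filter fun k => Nat.gcd k n ∈ E₂) ∪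
      x.primesLE.biUnion fun p => (Finset.range n).filter fun k => p ^ (Nat.log p x + 1) ∣ k)) := by
    intro k hk
    obtain ⟨hkr, hko⟩ := Finset.mem_filter.1 hk
    simp only [Finset.mem_union, Finset.mem_filter, Finset.mem_biUnion, hkr, true_and]
    have hgo : Odd (Nat.gcd k n) := hko.of_dvd_nat (Nat.gcd_dvd_left _ _)
    by_cases hgl : Nat.gcd k n ∣ lcmUpTo x
    · have hmem : Nat.gcd k n ∈ oddDivisors x :=
        Finset.mem_filter.2 ⟨Nat.mem_divisors.2 ⟨hgl, (lcmUpTo_pos x).ne'⟩, hgo⟩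
      by_cases h1 : ArithmeticFunction.cardFactors (Nat.gcd k n) ≤ exampleK x
      · exact Or.inr (Or.inl (Finset.mem_filter.2 ⟨hmem, h1⟩))
      by_cases h2 : 2 * exampleK x ≤ ArithmeticFunction.cardFactors (Nat.gcd k n)
      · exact Or.inr (Or.inr (Or.inl (Finset.mem_filter.2 ⟨hmem, h2⟩)))
      exact Or.inl ⟨hgl, hgo, not_le.1 h1, not_le.1 h2⟩
    · obtain ⟨p, hp, hpg⟩ := exists_prime_pow_dvd (Nat.gcd_dvd_right k n) hgl
      exact Or.inr (Or.inr (Or.inr ⟨p, hp, hpg.trans (Nat.gcd_dvd_left _ _)⟩))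
  have hcard := (Finset.card_le_card hsub).trans ((Finset.card_union_le _ _).trans
    (Nat.add_le_add_left ((Finset.card_union_le _ _).trans (Nat.add_le_add_left
      ((Finset.card_union_le _ _).trans (Nat.add_le_add_left Finset.card_biUnion_le _)) _)) _))
  have hcard' := (Nat.cast_le (α := ℝ)).2 hcard
  push_cast at hcard'
  rw [card_gcd_mem fun d hd => hdvd d (Finset.mem_filter.1 hd).1,
    card_gcd_mem fun d hd => hdvd d (Finset.mem_filter.1 hd).1] at hcard'
  have hprimes : ∑ p ∈ x.primesLE,
      (((Finset.range n).filter fun k => p ^ (Nat.log p x + 1) ∣ k).card : ℝ) ≤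
      n * ∑ p ∈ x.primesLE, ((p : ℝ) ^ (Nat.log p x + 1))⁻¹ := by
    rw [Finset.mul_sum]
    refine Finset.sum_le_sum fun p hp => ?_
    simpa using card_dvd_le (pow_log_add_one_dvd hp)
  have hodd := half_le_card_odd heven
  rw [density, ncard_exampleSet]
  refine le_of_mul_le_mul_left ?_ hn0
  set A := (((Finset.range n).filter fun k => Nat.gcd k n ∈ exampleDivisors x).card : ℝ)
  have e1 : (n : ℝ) * (1 / 2 - A / n) = n / 2 - A := by field_simp
  have e2 : ∀ s t u : ℝ, (n : ℝ) * ((Nat.totient n : ℝ) / n * (s + t) + u) =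
      Nat.totient n * s + Nat.totient n * t + n * u := by
    intro s t u
    field_simp
  rw [e1, e2]
  linarith

/-- The prime power q in each term is at least p² and at least x. Splitting 1/q = q^(-3/4) q^(-1/4)
uses the first bound for convergence and the second for decay in x. -/
theorem sum_primesLE_inv_pow_log_le {x : ℕ} (hx : x ≠ 0) :
    ∑ p ∈ x.primesLE, ((p : ℝ) ^ (Nat.log p x + 1))⁻¹ ≤
      (∑' m : ℕ, (m : ℝ) ^ (-(3 / 2) : ℝ)) * (x : ℝ) ^ (-(1 / 4) : ℝ) := by
  have hx0 : (0 : ℝ) < x := by positivity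
  have h : ∀ p ∈ x.primesLE, ((p : ℝ) ^ (Nat.log p x + 1))⁻¹ ≤
      (p : ℝ) ^ (-(3 / 2) : ℝ) * (x : ℝ) ^ (-(1 / 4) : ℝ) := by
    intro p hp
    have hpp := Nat.prime_of_mem_primesLE hp
    have hp0 : (0 : ℝ) < p := by exact_mod_cast hpp.pos
    have hp1 : (1 : ℝ) ≤ p := by exact_mod_cast hpp.one_le
    have h1 := Nat.log_pos hpp.one_lt (Nat.le_of_mem_primesLE hp)
    have hq1 : (x : ℝ) ≤ (p : ℝ) ^ (Nat.log p x + 1) := by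
      exact_mod_cast (Nat.lt_pow_succ_log_self hpp.one_lt x).le
    have hq2 : (p : ℝ) ^ 2 ≤ (p : ℝ) ^ (Nat.log p x + 1) :=
      pow_le_pow_right₀ hp1 (by omega)
    set q := (p : ℝ) ^ (Nat.log p x + 1)
    have hq0 : 0 < q := by positivity
    have e1 : q⁻¹ = q ^ (-(3 / 4) : ℝ) * q ^ (-(1 / 4) : ℝ) := by
      rw [← Real.rpow_add hq0, ← Real.rpow_neg_one]
      norm_num
    have e2 : (p : ℝ) ^ (-(3 / 2) : ℝ) = ((p : ℝ) ^ 2) ^ (-(3 / 4) : ℝ) := by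
      rw [← Real.rpow_natCast, ← Real.rpow_mul hp0.le]
      norm_num
    rw [e1, e2]
    exact mul_le_mul (Real.rpow_le_rpow_of_nonpos (by positivity) hq2 (by norm_num))
      (Real.rpow_le_rpow_of_nonpos hx0 hq1 (by norm_num)) (by positivity) (by positivity)
  refine (Finset.sum_le_sum h).trans ?_
  rw [← Finset.sum_mul]
  refine mul_le_mul_of_nonneg_right ?_ (by positivity)
  exact (Real.summable_nat_rpow.2 (by norm_num)).sum_le_tsum _ fun m _ => by positivity

/-! ### Size of the extreme Poisson terms. -/

/-- Stirling together with (Sz/K)^K ≤ e^(Sz-K). The best z is K/S, but a free z allows the limiting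
ratios e/4 and e/2, so that the floor in K enters only linearly. -/
theorem pow_div_factorial_le_exp {S z : ℝ} (hS : 0 < S) (hz : 0 < z) {K : ℕ} (hK : K ≠ 0) :
    S ^ K / K.factorial ≤
      Real.exp (S * z - K * Real.log z) / Real.sqrt (2 * Real.pi * K) := by
  have hK0 : (0 : ℝ) < K := by positivity
  have hst := Stirling.le_factorial_stirling K
  have hsq : 0 < Real.sqrt (2 * Real.pi * K) := Real.sqrt_pos.2 (by positivity)
  have h1 : (S * z / K) ^ K ≤ Real.exp (S * z - K) := by
    calc (S * z / K) ^ K ≤ Real.exp (S * z / K - 1) ^ K := by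
          gcongr
          linarith [Real.add_one_le_exp (S * z / K - 1)]
      _ = _ := by
          rw [← Real.exp_nat_mul]
          congr 1
          field_simp
  have h2 : Real.exp (S * z - K * Real.log z) = Real.exp (S * z - K) * Real.exp 1 ^ K / z ^ K := by
    rw [← Real.exp_nat_mul, ← Real.exp_add, mul_one, sub_add_cancel, Real.exp_sub,
      Real.exp_nat_mul, Real.exp_log hz]
  calc S ^ K / K.factorial ≤ S ^ K / (Real.sqrt (2 * Real.pi * K) * (K / Real.exp 1) ^ K) := by
        gcongr
    _ = (S * z / K) ^ K * Real.exp 1 ^ K / z ^ K / Real.sqrt (2 * Real.pi * K) := by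
        rw [div_pow, div_pow, mul_pow]
        field_simp
    _ ≤ _ := by
        rw [h2]
        gcongr

/-- The exponent `(e / 2) log 2`. -/
noncomputable def logExponent : ℝ := Real.exp 1 / 2 * Real.log 2

theorem logExponent_nonneg : 0 ≤ logExponent :=
  mul_nonneg (by positivity) (Real.log_nonneg (by norm_num))

theorem logExponent_le_one : logExponent ≤ 1 := by
  have h1 := Real.exp_one_lt_d9
  have h2 := Real.log_two_lt_d9
  have h3 : 0 ≤ Real.log 2 := Real.log_nonneg (by norm_num)
  rw [logExponent]
  nlinarith [Real.exp_pos 1]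

theorem log_exp_one_div_two : Real.log (Real.exp 1 / 2) = 1 - Real.log 2 := by
  rw [Real.log_div (Real.exp_pos 1).ne' two_ne_zero, Real.log_exp]

theorem log_exp_one_div_four : Real.log (Real.exp 1 / 4) = 1 - 2 * Real.log 2 := by
  rw [Real.log_div (Real.exp_pos 1).ne' four_ne_zero, Real.log_exp,
    show (4 : ℝ) = 2 ^ 2 by norm_num, Real.log_pow]
  norm_num

theorem lower_poisson_term_le {L : ℝ} (hL : 40 ≤ L) {K : ℕ} (hK : K = ⌊Real.exp 1 / 4 * L⌋₊) :
    (L + 3) ^ K / K.factorial ≤ Real.exp 5 * (Real.exp (logExponent * L) / Real.sqrt L) := by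
  have he1 := Real.exp_one_gt_d9
  have he2 := Real.exp_one_lt_d9
  have hl1 := Real.log_two_gt_d9
  have hKle : (K : ℝ) ≤ Real.exp 1 / 4 * L := by rw [hK]; exact Nat.floor_le (by positivity)
  have hKge : Real.exp 1 / 4 * L < K + 1 := by rw [hK]; exact Nat.lt_floor_add_one _
  have hKL : L / 2 ≤ K := by nlinarith
  have hK0 : K ≠ 0 := by rintro rfl; norm_num at hKL; linarith
  refine (pow_div_factorial_le_exp (z := Real.exp 1 / 4) (by linarith) (by positivity) hK0).trans ?_
  rw [log_exp_one_div_four, ← mul_div_assoc (Real.exp 5), ← Real.exp_add]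
  -- As 1 - 2 log 2 < 0, the upper bound on K is the one needed; the error is 3e/4.
  have hexp : (L + 3) * (Real.exp 1 / 4) - K * (1 - 2 * Real.log 2) ≤ 5 + logExponent * L := by
    rw [logExponent]
    nlinarith [mul_le_mul_of_nonneg_right hKle (show 0 ≤ 2 * Real.log 2 - 1 by linarith)]
  have hpi := Real.pi_gt_three
  have hsq : L ≤ 2 * Real.pi * K := by nlinarith
  have hL0 : 0 < Real.sqrt L := Real.sqrt_pos.2 (by linarith)
  gcongr

theorem upper_poisson_term_le {L : ℝ} (hL : 40 ≤ L) {K : ℕ} (hK : K = ⌊Real.exp 1 / 4 * L⌋₊) :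
    (L + 3) ^ (2 * K) / (2 * K).factorial ≤
      Real.exp 5 * (Real.exp (logExponent * L) / Real.sqrt L) := by
  have he1 := Real.exp_one_gt_d9
  have he2 := Real.exp_one_lt_d9
  have hl1 := Real.log_two_gt_d9
  have hl2 := Real.log_two_lt_d9
  have hKge : Real.exp 1 / 4 * L < K + 1 := by rw [hK]; exact Nat.lt_floor_add_one _
  have hKL : L / 2 ≤ K := by nlinarith
  have hK0 : 2 * K ≠ 0 := by
    intro h
    obtain rfl : K = 0 := by omega
    norm_num at hKL
    linarith
  refine (pow_div_factorial_le_exp (z := Real.exp 1 / 2) (by linarith) (by positivity) hK0).trans ?_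
  rw [log_exp_one_div_two, ← mul_div_assoc (Real.exp 5), ← Real.exp_add]
  push_cast
  -- As 1 - log 2 > 0, the lower bound on K is the one needed; the error is 3e/2 + 2(1 - log 2) < 5.
  have hexp : (L + 3) * (Real.exp 1 / 2) - 2 * K * (1 - Real.log 2) ≤ 5 + logExponent * L := by
    rw [logExponent]
    nlinarith [mul_le_mul_of_nonneg_right hKge.le (show 0 ≤ 1 - Real.log 2 by linarith)]
  have hpi := Real.pi_gt_three
  have hsq : L ≤ 2 * Real.pi * (2 * K) := by nlinarith
  have hL0 : 0 < Real.sqrt L := Real.sqrt_pos.2 (by linarith)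
  gcongr

/-! ### The density bound in terms of x. -/

theorem tendsto_log_log_atTop : Tendsto (fun x : ℕ => Real.log (Real.log x)) atTop atTop :=
  Real.tendsto_log_atTop.comp (Real.tendsto_log_atTop.comp tendsto_natCast_atTop_atTop)

theorem oddDivisors_spec {x d : ℕ} (hd : d ∈ oddDivisors x) :
    Odd d ∧ d.primeFactors ⊆ x.primesLE := by
  obtain ⟨hd, ho⟩ := Finset.mem_filter.1 hd
  refine ⟨ho, ?_⟩
  rw [← Nat.primeFactors_lcmUpto]
  exact Nat.primeFactors_mono (Nat.dvd_of_mem_divisors hd) (lcmUpTo_pos x).ne'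

theorem sum_inv_oddDivisors_le {x : ℕ} (hx : 3 ≤ x) (hL : 40 ≤ Real.log (Real.log x)) :
    ∑ d ∈ (oddDivisors x).filter (fun d => ArithmeticFunction.cardFactors d ≤ exampleK x),
        (d : ℝ)⁻¹ +
      ∑ d ∈ (oddDivisors x).filter (fun d => 2 * exampleK x ≤ ArithmeticFunction.cardFactors d),
        (d : ℝ)⁻¹ ≤
    squarePartConst * (10 * Real.exp 5) * (Real.exp (logExponent * Real.log (Real.log x)) /
      Real.sqrt (Real.log (Real.log x))) := by
  set L := Real.log (Real.log x) with hLdef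
  set K := exampleK x with hKdef
  have hK : K = ⌊Real.exp 1 / 4 * L⌋₊ := rfl
  have he1 := Real.exp_one_gt_d9
  have he2 := Real.exp_one_lt_d9
  have hKle : (K : ℝ) ≤ Real.exp 1 / 4 * L := by rw [hK]; exact Nat.floor_le (by positivity)
  have hKge : Real.exp 1 / 4 * L < K + 1 := by rw [hK]; exact Nat.lt_floor_add_one _
  have hK0 : K ≠ 0 := by
    intro h
    rw [h] at hKge
    norm_num at hKge
    nlinarith
  have hS : 0 < L + 3 := by linarith
  have hP := sum_primesLE_inv_le hx
  -- The ratios tend to e/4 ≈ 0.68 and e/2 ≈ 1.36, and L ≥ 40 keeps them away from 1 and below 3/2.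
  -- The geometric series then cost at most 4 and 6, whence the constant 10.
  have hr1 : (K : ℝ) / (L + 3) ≤ 3 / 4 := by rw [div_le_iff₀ hS]; nlinarith
  have hr2 : 6 / 5 ≤ ((2 * K : ℕ) : ℝ) / (L + 3) := by
    rw [le_div_iff₀ hS]; push_cast; nlinarith
  have hr3 : ((2 * K : ℕ) : ℝ) / (L + 3) ≤ 3 / 2 := by
    rw [div_le_iff₀ hS]; push_cast; nlinarith
  have h1 := sum_inv_cardFactors_le_le hS hK0 hP (by linarith)
    (D := (oddDivisors x).filter fun d => ArithmeticFunction.cardFactors d ≤ K) fun d hd =>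
      ⟨(oddDivisors_spec (Finset.mem_filter.1 hd).1).1,
        (oddDivisors_spec (Finset.mem_filter.1 hd).1).2, (Finset.mem_filter.1 hd).2⟩
  have h2 := sum_inv_le_cardFactors_le hS (K := 2 * K) (by omega) hP (by linarith) hr3
    (D := (oddDivisors x).filter fun d => 2 * K ≤ ArithmeticFunction.cardFactors d) fun d hd =>
      ⟨(oddDivisors_spec (Finset.mem_filter.1 hd).1).1,
        (oddDivisors_spec (Finset.mem_filter.1 hd).1).2, (Finset.mem_filter.1 hd).2⟩
  have h3 := lower_poisson_term_le hL hK
  have h4 := upper_poisson_term_le hL hK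
  have hM := squarePartConst_nonneg
  have g1 : (1 - (K : ℝ) / (L + 3))⁻¹ ≤ 4 := by
    rw [inv_le_comm₀ (by linarith) (by norm_num)]
    linarith
  have g2 : (1 - (((2 * K : ℕ) : ℝ) / (L + 3))⁻¹)⁻¹ ≤ 6 := by
    have : (((2 * K : ℕ) : ℝ) / (L + 3))⁻¹ ≤ 5 / 6 := by
      rw [inv_le_comm₀ (by linarith) (by norm_num)]
      linarith
    rw [inv_le_comm₀ (by linarith) (by norm_num)]
    linarith
  set B := Real.exp (logExponent * L) / Real.sqrt L
  have hB : 0 ≤ B := by positivity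
  have k1 := h1.trans (mul_le_mul (mul_le_mul_of_nonneg_left h3 hM) g1
    (inv_nonneg.2 (by linarith)) (by positivity))
  have k2 := h2.trans (mul_le_mul_of_nonneg_left g2 (by positivity))
  have k3 := mul_le_mul_of_nonneg_left h4 hM
  linarith

theorem exists_half_sub_density_le : ∃ C : ℝ, 0 < C ∧ ∀ x : ℕ, 3 ≤ x →
    40 ≤ Real.log (Real.log x) →
    1 / 2 - density (exampleSet x) ≤
      C / (Real.exp ((1 - logExponent) * Real.log (Real.log x)) *
        Real.sqrt (Real.log (Real.log x))) := by
  set C₁ := squarePartConst * (10 * Real.exp 5) with hC₁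
  set C₂ : ℝ := ∑' m : ℕ, (m : ℝ) ^ (-(3 / 2) : ℝ) with hC₂
  have hC₁0 : 0 ≤ C₁ := mul_nonneg squarePartConst_nonneg (by positivity)
  have hC₂0 : 0 ≤ C₂ := tsum_nonneg fun m => by positivity
  refine ⟨C₁ + 32 * C₂ + 1, by positivity, fun x hx hL => ?_⟩
  have h1 := half_sub_density_exampleSet_le (x := x) (by omega)
  have h2 := sum_inv_oddDivisors_le hx hL
  have h3 := totient_div_mul_log_le x
  have h4 := sum_primesLE_inv_pow_log_le (x := x) (by omega)
  rw [← hC₂] at h4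
  rw [← hC₁] at h2
  set L := Real.log (Real.log x) with hLdef
  have hlog : 0 < Real.log x := Real.log_pos (by exact_mod_cast (by omega : 1 < x))
  have hlogx : Real.log x = Real.exp L := (Real.exp_log hlog).symm
  have hx0 : (0 : ℝ) < x := by positivity
  have hsq : 0 < Real.sqrt L := Real.sqrt_pos.2 (by linarith)
  have hφ : (Nat.totient (exampleModulus x) : ℝ) / exampleModulus x ≤ Real.exp (-L) := by
    rw [hlogx] at h3
    rw [Real.exp_neg, ← one_div, le_div_iff₀ (Real.exp_pos L)]
    exact h3
  have hmain : Real.exp (-L) * (C₁ * (Real.exp (logExponent * L) / Real.sqrt L)) =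
      C₁ / (Real.exp ((1 - logExponent) * L) * Real.sqrt L) := by
    rw [show (1 - logExponent) * L = L - logExponent * L by ring, Real.exp_sub, Real.exp_neg]
    field_simp
  -- With u = e^L/4 we have x^(1/4) = e^u ≥ u²/2 = e^(2L)/32, while each factor of the denominator
  -- is at most e^L.
  have htail : (x : ℝ) ^ (-(1 / 4) : ℝ) ≤
      32 / (Real.exp ((1 - logExponent) * L) * Real.sqrt L) := by
    rw [Real.rpow_def_of_pos hx0, hlogx]
    have hq := Real.quadratic_le_exp_of_nonneg (x := Real.exp L / 4) (by positivity)
    have hb := logExponent_nonneg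
    have hE : Real.exp ((1 - logExponent) * L) ≤ Real.exp L :=
      Real.exp_le_exp.2 (by nlinarith)
    have hs : Real.sqrt L ≤ Real.exp L := by
      rw [Real.sqrt_le_left (Real.exp_pos L).le]
      have := Real.add_one_le_exp L
      nlinarith
    have hp := mul_le_mul hE hs hsq.le (Real.exp_pos L).le
    rw [show Real.exp L * -(1 / 4) = -(Real.exp L / 4) by ring, Real.exp_neg, ← one_div,
      div_le_div_iff₀ (Real.exp_pos _) (by positivity)]
    nlinarith [Real.exp_pos L]
  have hnn : 0 ≤ C₁ * (Real.exp (logExponent * L) / Real.sqrt L) := by positivity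
  calc _ ≤ _ := h1
    _ ≤ Real.exp (-L) * (C₁ * (Real.exp (logExponent * L) / Real.sqrt L)) +
        C₂ * (32 / (Real.exp ((1 - logExponent) * L) * Real.sqrt L)) := by
        refine add_le_add ((mul_le_mul_of_nonneg_left h2 (by positivity)).trans
          (mul_le_mul_of_nonneg_right hφ hnn)) (h4.trans (mul_le_mul_of_nonneg_left htail hC₂0))
    _ = (C₁ + 32 * C₂) / (Real.exp ((1 - logExponent) * L) * Real.sqrt L) := by
        rw [hmain]; ring
    _ ≤ _ := div_le_div_of_nonneg_right (by linarith) (by positivity)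

/-! ### From x to the modulus, and the conclusion. -/

theorem log_exampleModulus_le {x : ℕ} (hx : 3 ≤ x) : Real.log (exampleModulus x) ≤ (x : ℝ) ^ 3 := by
  have hx3 : (3 : ℝ) ≤ x := by exact_mod_cast hx
  have h1 : lcmUpTo x ≤ x ^ x :=
    (Nat.le_of_dvd (Nat.factorial_pos x) (Nat.lcmUpto_dvd_factorial x)).trans
      (Nat.factorial_le_pow x)
  have hl0 : (0 : ℝ) < lcmUpTo x := by exact_mod_cast lcmUpTo_pos x
  have h2 : Real.log (lcmUpTo x) ≤ x * Real.log x := by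
    rw [← Real.log_pow]
    exact Real.log_le_log hl0 (by exact_mod_cast h1)
  have h3 : Real.log x ≤ x := Real.log_le_self (by positivity)
  rw [exampleModulus]
  push_cast
  rw [Real.log_pow]
  push_cast
  nlinarith [mul_le_mul_of_nonneg_left h3 (show (0 : ℝ) ≤ x by positivity), sq_nonneg (x : ℝ)]

/-- The crude log n ≤ x³ gives log log n ≤ 3 log x and log log log n ≤ 4L. The exponents lie in [0,
1] and equal 1/2, so the losses are factors 3 and 2. -/
theorem rate_exampleModulus_pos_and_le {x : ℕ} (hx : 3 ≤ x) (hL : 40 ≤ Real.log (Real.log x)) :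
    0 < rate (exampleModulus x) ∧
      rate (exampleModulus x) ≤ 6 * (Real.exp ((1 - logExponent) * Real.log (Real.log x)) *
        Real.sqrt (Real.log (Real.log x))) := by
  have hn := log_exampleModulus_le hx
  have hx0 : (0 : ℝ) < x := by positivity
  have hxn : (x : ℝ) ≤ exampleModulus x := by exact_mod_cast le_exampleModulus x
  have hlog : 0 < Real.log x := Real.log_pos (by exact_mod_cast (by omega : 1 < x))
  have h1 : Real.log x ≤ Real.log (exampleModulus x) := Real.log_le_log hx0 hxn
  have h2 : Real.log (Real.log x) ≤ Real.log (Real.log (exampleModulus x)) :=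
    Real.log_le_log hlog h1
  have h3 : Real.log (Real.log (exampleModulus x)) ≤ 3 * Real.log x := by
    have := Real.log_le_log (by linarith) hn
    rwa [Real.log_pow, Nat.cast_ofNat] at this
  set M := Real.log (Real.log (exampleModulus x)) with hM
  set L := Real.log (Real.log x) with hLdef
  have hlogx : Real.log x = Real.exp L := (Real.exp_log hlog).symm
  have hM0 : 0 < M := by linarith
  have h4 : Real.log M ≤ 4 * L := by
    have := Real.log_le_log hM0 h3
    rw [Real.log_mul (by norm_num) hlog.ne'] at this
    have h5 : Real.log 3 ≤ 3 := Real.log_le_self (by norm_num)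
    linarith
  have h5 : 0 < Real.log M := Real.log_pos (by linarith)
  have hb0 := logExponent_nonneg
  have hb1 := logExponent_le_one
  change 0 < M ^ (1 - logExponent) * Real.log M ^ (1 / 2 : ℝ) ∧
    M ^ (1 - logExponent) * Real.log M ^ (1 / 2 : ℝ) ≤ _
  refine ⟨by positivity, ?_⟩
  have h6 : M ^ (1 - logExponent) ≤ 3 * Real.exp ((1 - logExponent) * L) := by
    calc M ^ (1 - logExponent) ≤ (3 * Real.exp L) ^ (1 - logExponent) := by
          rw [← hlogx]
          exact Real.rpow_le_rpow hM0.le h3 (by linarith)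
      _ = 3 ^ (1 - logExponent) * Real.exp ((1 - logExponent) * L) := by
          rw [Real.mul_rpow (by norm_num) (Real.exp_pos L).le, ← Real.exp_mul, mul_comm L]
      _ ≤ 3 ^ (1 : ℝ) * Real.exp ((1 - logExponent) * L) := by
          gcongr
          · norm_num
          · linarith
      _ = _ := by rw [Real.rpow_one]
  have h7 : Real.log M ^ (1 / 2 : ℝ) ≤ 2 * Real.sqrt L := by
    rw [← Real.sqrt_eq_rpow]
    calc Real.sqrt (Real.log M) ≤ Real.sqrt (2 ^ 2 * L) := by
          apply Real.sqrt_le_sqrt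
          linarith
      _ = _ := by
          rw [Real.sqrt_mul (by norm_num), Real.sqrt_sq (by norm_num)]
  calc _ ≤ 3 * Real.exp ((1 - logExponent) * L) * (2 * Real.sqrt L) :=
        mul_le_mul h6 h7 (by positivity) (by positivity)
    _ = _ := by ring

end SumProductFree

theorem theorem1p3 :
    ∃ κ' : ℝ, 0 < κ' ∧
      {n : ℕ | SumProductFree.maxDensity n ≥ 1 / 2 - κ' / SumProductFree.rate n}.Infinite ∧
      ∀ᶠ x : ℕ in atTop,
        SumProductFree.IsSumFree (SumProductFree.exampleSet x) ∧
        SumProductFree.IsProductFree (SumProductFree.exampleSet x) ∧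
        SumProductFree.density (SumProductFree.exampleSet x) ≥
          1 / 2 - κ' / SumProductFree.rate (SumProductFree.exampleModulus x) := by
  obtain ⟨C, hC, hdens⟩ := SumProductFree.exists_half_sub_density_le
  have hev : ∀ᶠ x : ℕ in atTop,
      SumProductFree.IsSumFree (SumProductFree.exampleSet x) ∧
      SumProductFree.IsProductFree (SumProductFree.exampleSet x) ∧
      SumProductFree.density (SumProductFree.exampleSet x) ≥
        1 / 2 - 6 * C / SumProductFree.rate (SumProductFree.exampleModulus x) := by
    filter_upwards [eventually_ge_atTop 3,
      SumProductFree.tendsto_log_log_atTop.eventually_ge_atTop 40] with x hx hL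
    refine ⟨SumProductFree.isSumFree_exampleSet (by omega),
      SumProductFree.isProductFree_exampleSet x, ?_⟩
    obtain ⟨hpos, hle⟩ := SumProductFree.rate_exampleModulus_pos_and_le hx hL
    have h1 := hdens x hx hL
    have h2 : C / (Real.exp ((1 - SumProductFree.logExponent) * Real.log (Real.log x)) *
        Real.sqrt (Real.log (Real.log x))) ≤
        6 * C / SumProductFree.rate (SumProductFree.exampleModulus x) := by
      have hsq : 0 < Real.sqrt (Real.log (Real.log x)) := Real.sqrt_pos.2 (by linarith)
      rw [div_le_div_iff₀ (by positivity) hpos]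
      nlinarith
    linarith
  refine ⟨6 * C, by positivity, ?_, hev⟩
  -- The moduli are unbounded since n ≥ x.
  refine Set.infinite_of_forall_exists_gt fun N => ?_
  obtain ⟨x, ⟨hs, hp, hd⟩, hx⟩ := (hev.and (eventually_gt_atTop N)).exists
  refine ⟨SumProductFree.exampleModulus x, ?_, hx.trans_le (SumProductFree.le_exampleModulus x)⟩
  exact hd.trans ((SumProductFree.isGreatest_maxDensity _
    (SumProductFree.exampleModulus_pos x).ne').2 ⟨_, hs, hp, rfl⟩)
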